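/- For $A\in\mathbb{C}^{n\times n}$, call $A$ \emph{uniform} if all its entries have the same modulus, and \emph{apportionable} if there is a nonsingular $M\in\mathbb{C}^{n\times n}$ such that $MAM^{-1}$ is uniform. Let $\operatorname{K}(A)\subseteq[0,\infty)$ be the set of all $\kappa\ge 0$ for which there is a nonsingular $M\in\mathbb{C}^{n\times n}$ such that every entry of $MAM^{-1}$ has modulus $\kappa$, and let $\rho(A)$ be the spectral radius of $A$, that is, the largest modulus of an eigenvalue of $A$. \textbf{Theorem.} Every $A\in\mathbb{C}^{n\times n}$ with $\operatorname{rank}(A)\le \frac n2$ is apportionable and, if moreover $A\neq O$, then $\left(\frac{\rho(A)}{2},\infty\right)\subseteq \operatorname{K}(A)$. -/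

import Mathlib

namespace Apportionment

/-- All entries of `B` have modulus equal to the nonnegative real number `κ`. -/
def HasCommonModulus {n : ℕ} (B : Matrix (Fin n) (Fin n) ℂ) (κ : ℝ) : Prop :=
  0 ≤ κ ∧ ∀ i j, ‖B i j‖ = κ

/-- A matrix is uniform if all its entries share the same modulus. -/
def IsUniform {n : ℕ} (B : Matrix (Fin n) (Fin n) ℂ) : Prop :=
  ∃ κ : ℝ, HasCommonModulus B κ

/-- A matrix is apportionable if `M * A * M⁻¹` is uniform for some nonsingular `M`. -/
def IsApportionable {n : ℕ} (A : Matrix (Fin n) (Fin n) ℂ) : Prop :=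
  ∃ M : Matrix (Fin n) (Fin n) ℂ, IsUnit M ∧ IsUniform (M * A * M⁻¹)

/-- The set `K(A)` of apportionment constants: the common moduli of the entries of the uniform
matrices `M * A * M⁻¹`, where `M` is nonsingular. -/
def apportionmentConstants {n : ℕ} (A : Matrix (Fin n) (Fin n) ℂ) : Set ℝ :=
  {κ | ∃ M : Matrix (Fin n) (Fin n) ℂ, IsUnit M ∧ HasCommonModulus (M * A * M⁻¹) κ}

/-- The spectral radius `ρ(A)`, the largest modulus of an eigenvalue of `A`, as a real number. -/
noncomputable def rho {n : ℕ} (A : Matrix (Fin n) (Fin n) ℂ) : ℝ :=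
  (spectralRadius ℂ A).toReal

/-- The conversion to a real number in `rho` loses nothing. -/
theorem spectralRadius_ne_top {n : ℕ} (A : Matrix (Fin n) (Fin n) ℂ) :
    spectralRadius ℂ A ≠ ⊤ := by
  have hfin : (spectrum ℂ A).Finite := A.finite_spectrum
  obtain ⟨C, hC⟩ := (hfin.image fun z : ℂ => ‖z‖₊).bddAbove
  refine ne_top_of_le_ne_top (ENNReal.coe_ne_top (r := C)) ?_
  exact iSup₂_le fun k hk => ENNReal.coe_le_coe.2 (hC ⟨k, hk, rfl⟩)

end Apportionment

open Matrix Module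

namespace Apportionment

/-! Let `r = A.rank > 0` and `W` the range of `A`. A basis of `W` gives a full-rank factorization `A
= X₀ Y₀` in which `Y₀ X₀` is the matrix `C` of `A` restricted to `W`. Since `rho A < 2κ`, the basis
can be chosen so that the entries of `C` have modulus below `2κ` (`exists_basis_norm_toMatrix_lt`).
Each entry is then a sum of two numbers of modulus `κ`, and `2r ≤ n` leaves room for both in one
column of an `n × r` matrix: `exists_injective_sum_fiber_eq` gives `C = Y X` with `X` injective,
entries of modulus `κ`, and the columns of `Y` standard basis vectors. Every column of `X Y` is a
column of `X`, so `X Y` is uniform. Finally `Y₀ X₀ = Y X` forces `X₀ Y₀` and `X Y` to be similar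
(`exists_linearEquiv_intertwining`). -/

/-! ### Sums of numbers and matrices with entries of modulus `κ` -/

/-- A complex number of modulus less than `2κ` is the sum of two distinct numbers of modulus `κ`. -/
theorem exists_add_eq_of_norm_lt {κ : ℝ} (hκ : 0 < κ) {c : ℂ} (hc : ‖c‖ < 2 * κ) :
    ∃ p q : ℂ, ‖p‖ = κ ∧ ‖q‖ = κ ∧ p + q = c ∧ p ≠ q := by
  rcases eq_or_ne c 0 with rfl | h0
  · refine ⟨κ, -κ, by simp [abs_of_pos hκ], by simp [abs_of_pos hκ], by simp, ?_⟩
    intro h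
    have h2 : (κ : ℂ) = 0 := self_eq_neg.mp h
    exact hκ.ne' (by exact_mod_cast h2)
  have hn : 0 < ‖c‖ := norm_pos_iff.2 h0
  have hpos : 0 < 4 * κ ^ 2 / ‖c‖ ^ 2 - 1 := by
    rw [sub_pos, lt_div_iff₀ (by positivity)]
    nlinarith
  -- The points `c / 2 * (1 ± s * I)` lie on the perpendicular bisector of `0` and `c`; this `s`
  -- puts them at distance `κ` from both. Strictness of `hc` gives `s > 0`, hence `p ≠ q`.
  set s : ℝ := √(4 * κ ^ 2 / ‖c‖ ^ 2 - 1) with hs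
  have hs0 : 0 < s := Real.sqrt_pos.2 hpos
  have hs2 : s ^ 2 = 4 * κ ^ 2 / ‖c‖ ^ 2 - 1 := Real.sq_sqrt hpos.le
  have key : ∀ x : ℝ, x ^ 2 = s ^ 2 → ‖c / 2 * (1 + x * Complex.I)‖ = κ := by
    intro x hx
    have h1 : ‖(1 + x * Complex.I : ℂ)‖ ^ 2 = 1 + x ^ 2 := by
      rw [← Complex.normSq_eq_norm_sq, Complex.normSq_apply]
      simp
      ring
    have h2 : ‖c / 2 * (1 + x * Complex.I)‖ ^ 2 = κ ^ 2 := by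
      rw [norm_mul, mul_pow, h1, hx, hs2, norm_div, Complex.norm_ofNat]
      field_simp
      ring
    exact (sq_eq_sq₀ (norm_nonneg _) hκ.le).1 h2
  refine ⟨c / 2 * (1 + s * Complex.I), c / 2 * (1 + (-s : ℝ) * Complex.I), key s rfl,
    key (-s) (by ring), by push_cast; ring, ?_⟩
  intro h
  have h3 : c * (s * Complex.I) = 0 := by
    push_cast at h
    linear_combination h
  simp [h0, hs0.ne'] at h3

/-- Subtracting suitable numbers of modulus `κ` keeps a complex number in the disc of
radius `2κ`. -/
theorem exists_norm_sub_sum_lt {κ : ℝ} (hκ : 0 < κ) (t : ℕ) {c : ℂ} (hc : ‖c‖ < 2 * κ) :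
    ∃ u : Fin t → ℂ, (∀ k, ‖u k‖ = κ) ∧ ‖c - ∑ k, u k‖ < 2 * κ := by
  induction t generalizing c with
  | zero => exact ⟨0, fun k => k.elim0, by simpa using hc⟩
  | succ t ih =>
    have : ∃ v : ℂ, ‖v‖ = κ ∧ ‖c - v‖ < 2 * κ := by
      obtain ⟨p, q, hp, hq, hpq, -⟩ := exists_add_eq_of_norm_lt hκ hc
      refine ⟨p, hp, ?_⟩
      rw [← hpq, add_sub_cancel_left, hq]
      linarith
    obtain ⟨v, hv, hcv⟩ := this
    obtain ⟨u, hu, hcu⟩ := ih hcv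
    refine ⟨Fin.cons v u, fun k => ?_, ?_⟩
    · cases k using Fin.cases <;> simp [hv, hu]
    · rw [Fin.sum_univ_succ]
      simpa [sub_sub] using hcu

/-- If two distinct values are allowed at each diagonal position, some choice makes the matrix
nonsingular. -/
theorem exists_det_add_diagonal_ne_zero {K : Type*} [Field K] {r : ℕ} (M : Matrix (Fin r) (Fin r) K)
    (a b : Fin r → K) (hab : ∀ i, a i ≠ b i) :
    ∃ d : Fin r → K, (∀ i, d i = a i ∨ d i = b i) ∧ (M + diagonal d).det ≠ 0 := by
  induction r with
  | zero => exact ⟨a, fun i => i.elim0, by simp⟩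
  | succ r ih =>
    obtain ⟨d, hd, hdet⟩ := ih (M.submatrix Fin.succ Fin.succ) (fun i => a i.succ)
      (fun i => b i.succ) fun i => hab i.succ
    -- The determinant is affine in the top left entry, with slope the complementary minor, nonzero
    -- by induction. So it cannot vanish at two distinct values.
    have key : ∀ x y : K, (M + diagonal (Fin.cons x d : Fin (r + 1) → K)).det -
        (M + diagonal (Fin.cons y d : Fin (r + 1) → K)).det =
        (x - y) * (M.submatrix Fin.succ Fin.succ + diagonal d).det := by
      intro x y
      have hsub : ∀ (z : K) (j : Fin (r + 1)),
          (M + diagonal (Fin.cons z d : Fin (r + 1) → K)).submatrix Fin.succ j.succAbove =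
          (M + diagonal (Fin.cons 0 d : Fin (r + 1) → K)).submatrix Fin.succ j.succAbove := by
        intro z j
        ext k l
        by_cases h : k.succ = j.succAbove l <;> simp [h]
        simp [← h]
      have h0 : (M + diagonal (Fin.cons 0 d : Fin (r + 1) → K)).submatrix Fin.succ Fin.succ =
          M.submatrix Fin.succ Fin.succ + diagonal d := by
        ext k l
        simp [diagonal_apply]
      rw [det_succ_row_zero, det_succ_row_zero, Fin.sum_univ_succ, Fin.sum_univ_succ]
      simp only [hsub x, hsub y]
      simp [h0, (Fin.succ_ne_zero _).symm]
      ring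
    by_cases h : (M + diagonal (Fin.cons (a 0) d : Fin (r + 1) → K)).det = 0
    · refine ⟨Fin.cons (b 0) d, fun i => ?_, fun h' => ?_⟩
      · cases i using Fin.cases <;> simp [hd]
      · have := key (a 0) (b 0)
        rw [h, h', sub_zero, eq_comm, mul_eq_zero, sub_eq_zero] at this
        exact this.elim (hab 0) hdet
    · refine ⟨Fin.cons (a 0) d, fun i => ?_, h⟩
      cases i using Fin.cases <;> simp [hd]

/-- A square matrix with entries of modulus less than `2κ` is the sum of two matrices with entries
of modulus `κ`, the first of them nonsingular. -/
theorem exists_add_eq_of_forall_norm_lt {κ : ℝ} (hκ : 0 < κ) {r : ℕ}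
    (C : Matrix (Fin r) (Fin r) ℂ) (hC : ∀ i j, ‖C i j‖ < 2 * κ) :
    ∃ P Q : Matrix (Fin r) (Fin r) ℂ, (∀ i j, ‖P i j‖ = κ) ∧ (∀ i j, ‖Q i j‖ = κ) ∧
      P + Q = C ∧ P.det ≠ 0 := by
  choose p q hp hq hpq hne using fun i j => exists_add_eq_of_norm_lt hκ (hC i j)
  -- Swapping the two summands at a diagonal position leaves the sum unchanged, so the diagonal
  -- choices are free to make `P` nonsingular.
  obtain ⟨d, hd, hdet⟩ := exists_det_add_diagonal_ne_zero (of p) (fun _ => 0)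
    (fun i => q i i - p i i) fun i h => hne i i (sub_eq_zero.1 h.symm).symm
  have key : ∀ i j, ((of p + diagonal d) i j = p i j ∨ (of p + diagonal d) i j = q i j) := by
    intro i j
    rcases eq_or_ne i j with rfl | hij
    · rcases hd i with h | h <;> simp [h]
    · simp [hij]
  refine ⟨of p + diagonal d, C - (of p + diagonal d), fun i j => ?_, fun i j => ?_, by simp, hdet⟩
  · rcases key i j with h | h <;> rw [h] <;> simp [hp, hq]
  · rw [Matrix.sub_apply]
    rcases key i j with h | h <;> rw [h, ← hpq] <;> simp [hp, hq]

/-- A square matrix with entries of modulus less than `2κ` arises from an injective matrix with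
entries of modulus `κ` by summing rows along the fibres of a surjection. -/
theorem exists_injective_sum_fiber_eq {κ : ℝ} (hκ : 0 < κ) {r n : ℕ} (hr : 0 < r)
    (hn : 2 * r ≤ n) (C : Matrix (Fin r) (Fin r) ℂ) (hC : ∀ i j, ‖C i j‖ < 2 * κ) :
    ∃ (X : Matrix (Fin n) (Fin r) ℂ) (f : Fin n → Fin r), (∀ k j, ‖X k j‖ = κ) ∧
      Function.Surjective f ∧ (∀ i j, ∑ k, (if f k = i then X k j else 0) = C i j) ∧
      Function.Injective X.mulVec := by
  obtain ⟨t, rfl⟩ := Nat.exists_eq_add_of_le hn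
  let i₀ : Fin r := ⟨0, hr⟩
  choose u hu hcu using fun j => exists_norm_sub_sum_lt hκ t (hC i₀ j)
  -- The `t = n - 2r` surplus rows are all charged to row `i₀`, which is corrected beforehand. The
  -- block `P` makes `X` injective.
  obtain ⟨P, Q, hP, hQ, hPQ, hdet⟩ := exists_add_eq_of_forall_norm_lt hκ
    (of fun i j => if i = i₀ then C i₀ j - ∑ k, u j k else C i j) (by
      intro i j
      rw [of_apply]
      split_ifs
      exacts [hcu j, hC i j])
  let e : Fin (2 * r + t) ≃ (Fin r ⊕ Fin r) ⊕ Fin t :=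
    (finCongr (by rw [two_mul])).trans
      (finSumFinEquiv.symm.trans (Equiv.sumCongr finSumFinEquiv.symm (Equiv.refl _)))
  let X' : (Fin r ⊕ Fin r) ⊕ Fin t → Fin r → ℂ := Sum.elim (Sum.elim P Q) fun k j => u j k
  let f' : (Fin r ⊕ Fin r) ⊕ Fin t → Fin r := Sum.elim (Sum.elim id id) fun _ => i₀
  refine ⟨of fun k => X' (e k), fun k => f' (e k), fun k j => ?_, fun i => ?_, fun i j => ?_, ?_⟩
  · rw [of_apply]
    rcases e k with (k | k) | k 
    exacts [hP k j, hQ k j, hu j k]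
  · exact ⟨e.symm (Sum.inl (Sum.inl i)), by simp [f']⟩
  · simp only [of_apply]
    rw [e.sum_comp fun k => if f' k = i then X' k j else 0]
    have := congrFun (congrFun hPQ i) j
    rw [Matrix.add_apply, of_apply] at this
    simp only [Fintype.sum_sum_type]
    change (∑ a, if a = i then P a j else 0) + (∑ a, if a = i then Q a j else 0) +
      ∑ a, (if i₀ = i then u j a else 0) = C i j
    simp only [Finset.sum_ite_eq', Finset.mem_univ, if_true]
    rw [this]
    by_cases h : i = i₀
    · simp [h]
    · simp [h, Ne.symm h]
  · intro v w hvw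
    refine (mulVec_injective_iff_isUnit.2 ((isUnit_iff_isUnit_det P).2 hdet.isUnit)) ?_
    ext i
    have := congrFun hvw (e.symm (Sum.inl (Sum.inl i)))
    simp only [mulVec, of_apply, e, X', Equiv.apply_symm_apply] at this
    exact this

/-! ### Similarity from full-rank factorizations -/

/-- An injective linear map can be carried to another one by an equivalence between targets of the
same dimension. -/
theorem exists_linearEquiv_comp_eq {K E V W : Type*} [Field K] [AddCommGroup E] [Module K E]
    [AddCommGroup V] [Module K V] [AddCommGroup W] [Module K W] [FiniteDimensional K V]
    [FiniteDimensional K W] (h : finrank K V = finrank K W) (i : E →ₗ[K] V) (j : E →ₗ[K] W)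
    (hi : Function.Injective i) (hj : Function.Injective j) :
    ∃ φ : V ≃ₗ[K] W, ∀ x, φ (i x) = j x := by
  have : FiniteDimensional K E := FiniteDimensional.of_injective i hi
  obtain ⟨p, hp⟩ := i.exists_leftInverse_of_injective (LinearMap.ker_eq_bot.2 hi)
  obtain ⟨q, hq⟩ := j.exists_leftInverse_of_injective (LinearMap.ker_eq_bot.2 hj)
  replace hp : ∀ x, p (i x) = x := fun x => LinearMap.congr_fun hp x
  replace hq : ∀ x, q (j x) = x := fun x => LinearMap.congr_fun hq x
  have hker : finrank K (LinearMap.ker p) = finrank K (LinearMap.ker q) := by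
    have h1 := p.finrank_range_add_finrank_ker
    have h2 := q.finrank_range_add_finrank_ker
    rw [LinearMap.range_eq_top.2 fun x => ⟨i x, hp x⟩, finrank_top] at h1
    rw [LinearMap.range_eq_top.2 fun x => ⟨j x, hq x⟩, finrank_top] at h2
    omega
  let θ := LinearEquiv.ofFinrankEq _ _ hker
  let g : V →ₗ[K] LinearMap.ker p :=
    (LinearMap.id - i ∘ₗ p).codRestrict _ fun x => by simp [hp]
  have hgi : ∀ x, g (i x) = 0 := fun x => Subtype.ext (by simp [g, hp])
  let φ : V →ₗ[K] W := j ∘ₗ p + (LinearMap.ker q).subtype ∘ₗ θ.toLinearMap ∘ₗ g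
  have hφ : ∀ x, φ x = j (p x) + θ (g x) := fun _ => rfl
  have hinj : Function.Injective φ := by
    refine (injective_iff_map_eq_zero φ).2 fun x hx => ?_
    have hpx : p x = 0 := by
      have := congrArg q hx
      rwa [hφ, map_add, hq, LinearMap.mem_ker.1 (θ (g x)).2, add_zero, map_zero] at this
    rw [hφ, hpx, map_zero, zero_add, Submodule.coe_eq_zero, LinearEquiv.map_eq_zero_iff] at hx
    simpa [g, hpx] using congrArg Subtype.val hx
  refine ⟨LinearEquiv.ofInjectiveOfFinrankEq φ hinj h, fun x => ?_⟩
  change φ (i x) = j x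
  rw [hφ, hp, hgi]
  simp

/-- Full-rank factorizations `X₀ Y₀` and `X Y` with `Y₀ X₀ = Y X` are simultaneously equivalent. -/
theorem exists_linearEquiv_intertwining {K E V : Type*} [Field K] [AddCommGroup E] [Module K E]
    [AddCommGroup V] [Module K V] [FiniteDimensional K V]
    (X₀ X : E →ₗ[K] V) (Y₀ Y : V →ₗ[K] E) (hX₀ : Function.Injective X₀)
    (hX : Function.Injective X) (hY₀ : Function.Surjective Y₀) (hY : Function.Surjective Y)
    (h : ∀ x, Y₀ (X₀ x) = Y (X x)) :
    ∃ M : V ≃ₗ[K] V, (∀ x, M (X₀ x) = X x) ∧ ∀ v, Y (M v) = Y₀ v := by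
  have : FiniteDimensional K E := FiniteDimensional.of_injective X hX
  let C : E →ₗ[K] E := Y ∘ₗ X
  -- A generalized inverse `D` of `C` splits `x` as `D (C x)` plus an element of `LinearMap.ker C`.
  obtain ⟨D, hD⟩ : ∃ D : E →ₗ[K] E, ∀ x, C (D (C x)) = C x := by
    obtain ⟨l, hl⟩ := C.rangeRestrict.exists_rightInverse_of_surjective C.range_rangeRestrict
    obtain ⟨p, hp⟩ := (LinearMap.range C).subtype.exists_leftInverse_of_injective
      (Submodule.ker_subtype _)
    refine ⟨l ∘ₗ p, fun x => ?_⟩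
    have h1 : p (C x) = C.rangeRestrict x := LinearMap.congr_fun hp (C.rangeRestrict x)
    have h2 := congrArg Subtype.val (LinearMap.congr_fun hl (C.rangeRestrict x))
    simpa [h1] using h2
  have section_aux : ∀ (Z : E →ₗ[K] V) (T : V →ₗ[K] E), Function.Surjective T →
      (∀ x, T (Z x) = C x) → ∃ σ : E →ₗ[K] V, (∀ x, T (σ x) = x) ∧
        ∀ x, σ (C x) = Z (D (C x)) := by
    intro Z T hT hTZ
    obtain ⟨s, hs⟩ := T.exists_rightInverse_of_surjective (LinearMap.range_eq_top.2 hT)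
    replace hs : ∀ x, T (s x) = x := fun x => LinearMap.congr_fun hs x
    -- `T` kills `Z - s ∘ₗ C`, so the correction keeps a section while matching it to `Z` on the
    -- range of `C`.
    refine ⟨s + (Z - s ∘ₗ C) ∘ₗ D, fun x => ?_, fun x => ?_⟩
    · simp [hs, hTZ]
    · simp [hD]
  obtain ⟨σ₀, hσ₀, hσ₀C⟩ := section_aux X₀ Y₀ hY₀ h
  obtain ⟨σ, hσ, hσC⟩ := section_aux X Y hY fun _ => rfl
  have hdim : finrank K (LinearMap.ker Y₀) = finrank K (LinearMap.ker Y) := by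
    have h1 := Y₀.finrank_range_add_finrank_ker
    have h2 := Y.finrank_range_add_finrank_ker
    rw [LinearMap.range_eq_top.2 hY₀] at h1
    rw [LinearMap.range_eq_top.2 hY] at h2
    omega
  -- `X₀` and `X` embed `LinearMap.ker C` in the kernels of `Y₀` and `Y`; `φ` matches these
  -- embeddings, and `N` below combines it with `σ₀ ↦ σ`.
  obtain ⟨φ, hφ⟩ := exists_linearEquiv_comp_eq hdim
    ((X₀ ∘ₗ (LinearMap.ker C).subtype).codRestrict (LinearMap.ker Y₀) fun x => by
      rw [LinearMap.mem_ker]; exact (h x).trans x.2)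
    ((X ∘ₗ (LinearMap.ker C).subtype).codRestrict (LinearMap.ker Y) fun x => x.2)
    (fun x y hxy => Subtype.ext (hX₀ (congrArg Subtype.val hxy)))
    (fun x y hxy => Subtype.ext (hX (congrArg Subtype.val hxy)))
  let g : V →ₗ[K] LinearMap.ker Y₀ :=
    (LinearMap.id - σ₀ ∘ₗ Y₀).codRestrict _ fun x => by simp [hσ₀]
  let N : V →ₗ[K] V := σ ∘ₗ Y₀ + (LinearMap.ker Y).subtype ∘ₗ φ.toLinearMap ∘ₗ g
  have hN : ∀ v, N v = σ (Y₀ v) + φ (g v) := fun _ => rfl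
  have hYN : ∀ v, Y (N v) = Y₀ v := fun v => by
    rw [hN, map_add, hσ, LinearMap.mem_ker.1 (φ (g v)).2, add_zero]
  have hNX : ∀ x, N (X₀ x) = X x := by
    intro x
    let k : LinearMap.ker C := ⟨x - D (C x), by simp [hD]⟩
    have hg : g (X₀ x) = ((X₀ ∘ₗ (LinearMap.ker C).subtype).codRestrict (LinearMap.ker Y₀)
        fun x => by rw [LinearMap.mem_ker]; exact (h x).trans x.2) k := by
      refine Subtype.ext ?_
      change X₀ x - σ₀ (Y₀ (X₀ x)) = X₀ (x - D (C x))
      rw [h, map_sub]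
      exact congrArg _ (hσ₀C x)
    rw [hN, hg, hφ, h]
    change σ (C x) + X (x - D (C x)) = X x
    rw [hσC, ← map_add, add_sub_cancel]
  have hinj : Function.Injective N := by
    refine (injective_iff_map_eq_zero N).2 fun x hx => ?_
    have hx0 : Y₀ x = 0 := by rw [← hYN, hx, map_zero]
    rw [hN, hx0, map_zero, zero_add, Submodule.coe_eq_zero, LinearEquiv.map_eq_zero_iff] at hx
    simpa [g, hx0] using congrArg Subtype.val hx
  exact ⟨LinearEquiv.ofInjectiveEndo N hinj, hNX, hYN⟩

/-! ### Triangular form with small off-diagonal entries -/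

/-- The coordinates in a basis that extends a basis of a hyperplane by one vector. -/
theorem repr_mkFinCons_smul_add {K V : Type*} [Field K] [AddCommGroup V] [Module K V] {m : ℕ}
    {H : Submodule K V} (y : V) (b : Basis (Fin m) K H)
    (hli : ∀ (c : K), ∀ x ∈ H, c • y + x = 0 → c = 0) (hsp : ∀ z : V, ∃ c : K, z + c • y ∈ H)
    (c : K) (x : H) :
    ⇑((Basis.mkFinCons y b hli hsp).repr (c • y + x)) = Fin.cons c (b.repr x) := by
  have hx : (x : V) = ∑ i, b.repr x i • (b i : V) := by
    have := congrArg H.subtype (b.sum_repr x)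
    rw [map_sum] at this
    exact this.symm
  have : c • y + (x : V) = (Basis.mkFinCons y b hli hsp).equivFun.symm
      (Fin.cons c (b.repr x)) := by
    rw [Basis.equivFun_symm_apply, Fin.sum_univ_succ, hx]
    simp [Basis.coe_mkFinCons]
  rw [this, ← Basis.equivFun_apply, LinearEquiv.apply_symm_apply]

/-- An endomorphism whose eigenvalues have modulus less than `δ` has a matrix with entries of
modulus less than `δ`. -/
theorem exists_basis_norm_toMatrix_lt {δ : ℝ} (hδ : 0 < δ) (m : ℕ) {V : Type*} [AddCommGroup V]
    [Module ℂ V] [FiniteDimensional ℂ V] (hm : finrank ℂ V = m) (f : End ℂ V)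
    (hf : ∀ μ, f.HasEigenvalue μ → ‖μ‖ < δ) :
    ∃ b : Basis (Fin m) ℂ V, ∀ i j, ‖LinearMap.toMatrix b b f i j‖ < δ := by
  induction m generalizing V with
  | zero => exact ⟨finBasisOfFinrankEq ℂ V hm, fun i => i.elim0⟩
  | succ m ih =>
    have : Nontrivial V := nontrivial_of_finrank_pos (R := ℂ) (by omega)
    obtain ⟨μ, hμ⟩ := End.exists_eigenvalue (K := ℂ) (V := Dual ℂ V) f.dualMap
    obtain ⟨ψ, hψ⟩ := hμ.exists_hasEigenvector
    have hψf : ∀ x, ψ (f x) = μ * ψ x := fun x => LinearMap.congr_fun hψ.apply_eq_smul x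
    obtain ⟨y, hy⟩ : ∃ y, ψ y ≠ 0 := by
      by_contra! h
      exact hψ.2 (LinearMap.ext h)
    -- The nonzero functional `ψ` vanishes on the range of `f - μ`, so `f - μ` is not surjective.
    have hfμ : f.HasEigenvalue μ := by
      rw [End.hasEigenvalue_iff_mem_spectrum, spectrum.mem_iff]
      intro hu
      obtain ⟨x, hx⟩ := ((End.isUnit_iff _).1 hu).2 y
      apply hy
      rw [← hx]
      simp [hψf]
    let H := LinearMap.ker ψ
    have hfH : ∀ x ∈ H, f x ∈ H := fun x hx => by
      rw [LinearMap.mem_ker] at hx ⊢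
      rw [hψf, hx, mul_zero]
    have hH : finrank ℂ H = m := by
      have h1 := ψ.finrank_range_add_finrank_ker
      rw [LinearMap.range_eq_top.2 (LinearMap.surjective fun h => hψ.2 h), finrank_top,
        finrank_self] at h1
      change finrank ℂ (LinearMap.ker ψ) = m
      omega
    obtain ⟨b, hb⟩ := ih hH (f.restrict hfH) fun ν hν => by
      obtain ⟨x, hx⟩ := hν.exists_hasEigenvector
      refine hf ν (End.hasEigenvalue_of_hasEigenvector (x := (x : V)) ⟨?_, ?_⟩)
      · exact End.mem_eigenspace_iff.2 (congrArg Subtype.val hx.apply_eq_smul)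
      · simpa using hx.2
    let w : H := ⟨f y - μ • y, by simp [H, hψf]⟩
    -- Replacing `y` by `ε • y` scales the part of the new column below the diagonal by `ε`.
    obtain ⟨ε, hε, hεw⟩ : ∃ ε : ℝ, 0 < ε ∧ ∀ i, ε * ‖b.repr w i‖ < δ := by
      refine ⟨δ / (1 + ∑ i, ‖b.repr w i‖), by positivity, fun i => ?_⟩
      rw [div_mul_eq_mul_div, div_lt_iff₀ (by positivity)]
      have : ‖b.repr w i‖ ≤ ∑ i, ‖b.repr w i‖ :=
        Finset.single_le_sum (f := fun i => ‖b.repr w i‖) (fun i _ => norm_nonneg _)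
          (Finset.mem_univ i)
      exact mul_lt_mul_of_pos_left (by linarith) hδ
    have hε' : (ε : ℂ) ≠ 0 := by exact_mod_cast hε.ne'
    have hli : ∀ (c : ℂ), ∀ x ∈ H, c • ((ε : ℂ) • y) + x = 0 → c = 0 := by
      intro c x hx h
      have := congrArg ψ h
      simpa [LinearMap.mem_ker.1 hx, hε', hy] using this
    have hsp : ∀ z : V, ∃ c : ℂ, z + c • ((ε : ℂ) • y) ∈ H := by
      intro z
      refine ⟨-(ψ z / (ε * ψ y)), ?_⟩
      simp only [H, LinearMap.mem_ker, map_add, map_smul, smul_eq_mul]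
      field_simp
      ring
    refine ⟨Basis.mkFinCons ((ε : ℂ) • y) b hli hsp, fun i j => ?_⟩
    rw [LinearMap.toMatrix_apply]
    cases j using Fin.cases with
    | zero =>
      have h1 : f ((ε : ℂ) • y) = μ • ((ε : ℂ) • y) + (((ε : ℂ) • w : H) : V) := by
        simp only [map_smul, Submodule.coe_smul, w]
        module
      rw [Basis.coe_mkFinCons, Fin.cons_zero, h1, repr_mkFinCons_smul_add]
      cases i using Fin.cases with
      | zero => simpa using hf μ hfμ
      | succ i =>
        rw [Fin.cons_succ, map_smul, Finsupp.smul_apply, norm_smul, Complex.norm_real,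
          Real.norm_of_nonneg hε.le]
        exact hεw i
    | succ j =>
      have h1 : f (b j) = (0 : ℂ) • ((ε : ℂ) • y) + ((f.restrict hfH (b j) : H) : V) := by
        simp
      rw [Basis.coe_mkFinCons, Fin.cons_succ, Function.comp_apply, h1, repr_mkFinCons_smul_add]
      cases i using Fin.cases with
      | zero => simpa using hδ
      | succ i => simpa [LinearMap.toMatrix_apply] using hb i j

/-! ### Assembly -/

/-- Eigenvalues are bounded by the spectral radius. -/
theorem norm_le_rho {n : ℕ} (A : Matrix (Fin n) (Fin n) ℂ) {μ : ℂ}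
    (hμ : End.HasEigenvalue (toLin' A) μ) : ‖μ‖ ≤ rho A := by
  rw [End.hasEigenvalue_iff_mem_spectrum, spectrum_toLin'] at hμ
  have h : ((‖μ‖₊ : NNReal) : ENNReal) ≤ spectralRadius ℂ A :=
    le_iSup₂ (f := fun k (_ : k ∈ spectrum ℂ A) => ((‖k‖₊ : NNReal) : ENNReal)) μ hμ
  simpa [rho] using ENNReal.toReal_mono (spectralRadius_ne_top A) h

/-- A nonzero matrix of rank at most half its size is similar to a uniform matrix of modulus `κ`
for each `κ` above half its spectral radius. -/
theorem mem_apportionmentConstants {n : ℕ} (A : Matrix (Fin n) (Fin n) ℂ) (hA : 2 * A.rank ≤ n)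
    (h0 : A ≠ 0) {κ : ℝ} (hκ : rho A / 2 < κ) : κ ∈ apportionmentConstants A := by
  have hκ0 : 0 < κ := lt_of_le_of_lt (div_nonneg ENNReal.toReal_nonneg zero_le_two) hκ
  let a : End ℂ (Fin n → ℂ) := toLin' A
  let W : Submodule ℂ (Fin n → ℂ) := LinearMap.range a
  have haW : ∀ x ∈ W, a x ∈ W := fun x _ => LinearMap.mem_range_self a x
  have hr : 0 < A.rank := by
    rw [Nat.pos_iff_ne_zero, Ne, rank, Submodule.finrank_eq_zero, LinearMap.range_eq_bot]
    intro h
    exact h0 (toLin'.injective (by rw [map_zero]; exact h))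
  obtain ⟨b, hb⟩ : ∃ b : Basis (Fin A.rank) ℂ W,
      ∀ i j, ‖LinearMap.toMatrix b b (a.restrict haW) i j‖ < 2 * κ :=
    exists_basis_norm_toMatrix_lt (by positivity) A.rank rfl (a.restrict haW) fun μ hμ => by
      obtain ⟨x, hx⟩ := hμ.exists_hasEigenvector
      have : a.HasEigenvalue μ := by
        refine End.hasEigenvalue_of_hasEigenvector (x := (x : Fin n → ℂ)) ⟨?_, ?_⟩
        · exact End.mem_eigenspace_iff.2 (congrArg Subtype.val hx.apply_eq_smul)
        · simpa using hx.2
      linarith [norm_le_rho A this]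
  obtain ⟨X, f, hX, hf, hfX, hXinj⟩ := exists_injective_sum_fiber_eq hκ0 hr hA _ hb
  let Y : Matrix (Fin A.rank) (Fin n) ℂ := of fun i k => if f k = i then 1 else 0
  have hYX : Y * X = LinearMap.toMatrix b b (a.restrict haW) := by
    ext i j
    rw [← hfX, mul_apply]
    simp [Y]
  have hYsurj : Function.Surjective (toLin' Y) := by
    obtain ⟨g, hg⟩ := hf.hasRightInverse
    intro v
    refine ⟨∑ i, Pi.single (g i) (v i), ?_⟩
    ext j
    simp [Y, hg _, mulVec_single]
  obtain ⟨M, hMX, hYM⟩ := exists_linearEquiv_intertwining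
    (W.subtype ∘ₗ b.equivFun.symm.toLinearMap) (toLin' X)
    (b.equivFun.toLinearMap ∘ₗ a.rangeRestrict) (toLin' Y)
    (W.injective_subtype.comp b.equivFun.symm.injective) hXinj
    (b.equivFun.surjective.comp a.surjective_rangeRestrict) hYsurj (fun x => by
      rw [← toLin'_mul_apply, hYX, toLin'_apply]
      have := LinearMap.toMatrix_mulVec_repr b b (a.restrict haW) (b.equivFun.symm x)
      rw [← Basis.equivFun_apply, ← Basis.equivFun_apply, LinearEquiv.apply_symm_apply] at this
      rw [this]
      rfl)
  have hunit : IsUnit (LinearMap.toMatrix' M.toLinearMap) := by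
    refine IsUnit.of_mul_eq_one (LinearMap.toMatrix' M.symm.toLinearMap) ?_
    rw [← LinearMap.toMatrix'_comp]
    simp
  -- `M X₀ = X` and `Y M = Y₀` give `M A = M X₀ Y₀ = X Y M`.
  have hsim : LinearMap.toMatrix' M.toLinearMap * A =
      X * Y * LinearMap.toMatrix' M.toLinearMap := by
    apply toLin'.injective
    refine LinearMap.ext fun v => ?_
    simp only [toLin'_mul_apply, toLin'_toMatrix', LinearEquiv.coe_coe]
    rw [hYM, ← hMX]
    simp only [LinearMap.comp_apply, LinearEquiv.coe_coe, LinearEquiv.symm_apply_apply]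
    rfl
  refine ⟨LinearMap.toMatrix' M.toLinearMap, hunit, hκ0.le, fun i j => ?_⟩
  rw [hsim, mul_nonsing_inv_cancel_right _ _ ((isUnit_iff_isUnit_det _).1 hunit), mul_apply]
  simpa [Y] using hX i (f j)

end Apportionment

theorem mainTheorem2 (n : ℕ) (A : Matrix (Fin n) (Fin n) ℂ)
    (hA : (A.rank : ℝ) ≤ (n : ℝ) / 2) :
    Apportionment.IsApportionable A ∧
      (A ≠ 0 → Set.Ioi (Apportionment.rho A / 2) ⊆ Apportionment.apportionmentConstants A) := by
  have hn : 2 * A.rank ≤ n := by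
    have : (2 * A.rank : ℝ) ≤ n := by linarith
    exact_mod_cast this
  refine ⟨?_, fun h0 κ hκ => Apportionment.mem_apportionmentConstants A hn h0 hκ⟩
  rcases eq_or_ne A 0 with rfl | h0
  · exact ⟨1, isUnit_one, 0, le_rfl, by simp⟩
  · obtain ⟨M, hM, hu⟩ := Apportionment.mem_apportionmentConstants A hn h0
      (lt_add_one (Apportionment.rho A / 2))
    exact ⟨M, hM, _, hu⟩
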